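/- For an odd prime $p$ let $$T(p)=\sqrt{p}\sum_{n=1}^{(p-1)/2}\tan\frac{\pi n^2}{p},\qquad C(p)=\sqrt{p}\sum_{n=1}^{(p-1)/2}\cot\frac{\pi n^2}{p},$$ and let $q_o(p)$ and $q_e(p)$ be, respectively, the number of odd and of even quadratic residues modulo $p$ in the set $\{1,2,\ldots,p-1\}$. Then: 1. $C(3)=1$. 2. For every prime $p\equiv 3\pmod 4$ with $p>3$, $C(p)$ is an odd positive integer that is divisible by $p$ and not divisible by $p^2$. 3. For every prime $p\equiv 3\pmod 8$, $T(p)$ is an integer that is a multiple of $3$. 4. For every prime $p\equiv 3\pmod 8$ with $p>3$, $q_o(p)-q_e(p)$ is a positive multiple of $3$. -/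

import Mathlib

/-- `T(p) = √p ∑_{n=1}^{(p-1)/2} tan (π n² / p)`. -/
noncomputable def tanSum (p : ℕ) : ℝ :=
  Real.sqrt (p : ℝ) *
    ∑ n ∈ Finset.Icc 1 ((p - 1) / 2), Real.tan (Real.pi * (n : ℝ) ^ 2 / (p : ℝ))

/-- `C(p) = √p ∑_{n=1}^{(p-1)/2} cot (π n² / p)`. -/
noncomputable def cotSum (p : ℕ) : ℝ :=
  Real.sqrt (p : ℝ) *
    ∑ n ∈ Finset.Icc 1 ((p - 1) / 2), Real.cot (Real.pi * (n : ℝ) ^ 2 / (p : ℝ))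

open Classical in
/-- The number `q_o(p)` of odd quadratic residues mod `p` in `{1, …, p - 1}`. -/
noncomputable def oddResidues (p : ℕ) : ℕ :=
  ((Finset.Icc 1 (p - 1)).filter (fun k : ℕ => Odd k ∧ IsSquare (k : ZMod p))).card

open Classical in
/-- The number `q_e(p)` of even quadratic residues mod `p` in `{1, …, p - 1}`. -/
noncomputable def evenResidues (p : ℕ) : ℕ :=
  ((Finset.Icc 1 (p - 1)).filter (fun k : ℕ => Even k ∧ IsSquare (k : ZMod p))).card

/-! Write `χ` for the quadratic character mod `p` and `M = ∑ j χ(j)` for its first moment. For `p ≡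
3 mod 4`, `χ` is odd, so summing an odd function over the nonzero squares gives half its
`χ`-weighted sum. Expanding the cotangent in a finite Fourier series and inserting the Gauss sum
`i√p` gives `C(p) = -M` (`cotSum_eq`). The sign of the Gauss sum matters and is obtained by
Kronecker's comparison with a product of sines (`gaussSum_quadCharC`).

Positivity is analytic: `L(1, χ) = π/(2p) ∑ χ(k) cot(πk/p)` is nonnegative by the Euler product and
nonzero by Dirichlet's theorem. The rest is arithmetic on `M`: mod 2 it is `p(p-1)/2`; mod `p` it is
a vanishing power sum; and `|M| ≤ p(p-1)/2` excludes `p²`.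

For `p ≡ 3 mod 8`, `χ(2) = -1`. Then `tan y = cot y - 2 cot 2y` yields `T(p) = 3 C(p)`, and doubling
residues yields `p (q_o - q_e) = -3M` (`mul_oddCharSum`). -/

open Polynomial in
/-- The Euler operator `X d/dX` on polynomials. -/
noncomputable def eulerOp {R : Type*} [CommRing R] (f : R[X]) : R[X] := X * derivative f

/-! ### The operator `X d/dX` and vanishing at 1 -/

section EulerOp
open Polynomial

variable {R : Type*} [CommRing R]

lemma eulerOp_add (f g : R[X]) : eulerOp (f + g) = eulerOp f + eulerOp g := by
  simp [eulerOp, mul_add]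

lemma eulerOp_iterate_add (n : ℕ) (f g : R[X]) :
    eulerOp^[n] (f + g) = eulerOp^[n] f + eulerOp^[n] g := by
  induction n generalizing f g with
  | zero => rfl
  | succ n ih => simp [eulerOp_add, ih]

lemma eulerOp_iterate_zero (n : ℕ) : eulerOp^[n] (0 : R[X]) = 0 := by
  induction n with
  | zero => rfl
  | succ n ih => simpa [eulerOp] using ih

lemma eulerOp_iterate_sum {ι : Type*} (s : Finset ι) (n : ℕ) (f : ι → R[X]) :
    eulerOp^[n] (∑ i ∈ s, f i) = ∑ i ∈ s, eulerOp^[n] (f i) := by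
  classical
  induction s using Finset.induction_on with
  | empty => simp [eulerOp_iterate_zero]
  | insert a s ha ih => rw [Finset.sum_insert ha, Finset.sum_insert ha, eulerOp_iterate_add, ih]

lemma eulerOp_C_mul_X_pow (c : R) (j : ℕ) :
    eulerOp (C c * X ^ j) = C (c * j) * X ^ j := by
  rcases j with _ | j
  · simp [eulerOp]
  · rw [eulerOp, derivative_C_mul, derivative_X_pow, C_mul, Nat.add_sub_cancel, pow_succ]
    ring

lemma eulerOp_iterate_C_mul_X_pow (n : ℕ) (c : R) (j : ℕ) :
    eulerOp^[n] (C c * X ^ j) = C (c * (j : R) ^ n) * X ^ j := by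
  induction n generalizing c with
  | zero => simp
  | succ n ih => rw [Function.iterate_succ_apply, eulerOp_C_mul_X_pow, ih, pow_succ']; ring_nf

lemma eulerOp_X_sub_one_pow_mul (k : ℕ) (g : R[X]) :
    eulerOp ((X - 1) ^ (k + 1) * g) =
      (X - 1) ^ k * (((k + 1 : ℕ) : R[X]) * X * g + (X - 1) * eulerOp g) := by
  simp only [eulerOp, derivative_mul, derivative_pow, derivative_sub, derivative_X, derivative_one,
    Nat.add_sub_cancel, map_natCast]
  ring

/-- By Leibniz, each application lowers the order of the zero at 1 by one and multiplies the leading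
coefficient there by that order. -/
lemma eval_eulerOp_iterate_X_sub_one_pow_mul (m : ℕ) (g : R[X]) :
    (eulerOp^[m] ((X - 1) ^ m * g)).eval 1 = m.factorial * g.eval 1 := by
  induction m generalizing g with
  | zero => simp
  | succ m ih =>
    rw [Function.iterate_succ_apply, eulerOp_X_sub_one_pow_mul, ih, Nat.factorial_succ]
    simp
    ring

end EulerOp

/-! ### Kronecker's comparison modulo `p` -/

section GaussSign
open Polynomial

lemma prod_range_two_mul {M : Type*} [CommMonoid M] (f : ℕ → M) (m : ℕ) :
    ∏ i ∈ Finset.range (2 * m), f i =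
      (∏ k ∈ Finset.range m, f (2 * k)) * ∏ k ∈ Finset.range m, f (2 * k + 1) := by
  induction m with
  | zero => simp
  | succ m ih =>
    rw [Nat.mul_succ, Finset.prod_range_succ, Finset.prod_range_succ, ih,
      Finset.prod_range_succ, Finset.prod_range_succ]
    ac_rfl

/-- Reindexing of a product over `1, …, 2m` by the odd numbers `a` and their complements. -/
lemma prod_range_odd_mul_compl {M : Type*} [CommMonoid M] (f : ℕ → M) (m : ℕ) :
    ∏ i ∈ Finset.range (2 * m), f (i + 1) =
      ∏ k ∈ Finset.range m, (f (2 * k + 1) * f (2 * m + 1 - (2 * k + 1))) := by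
  rw [prod_range_two_mul, Finset.prod_mul_distrib]
  congr 1
  rw [← Finset.prod_range_reflect]
  refine Finset.prod_congr rfl fun k hk => ?_
  have := Finset.mem_range.1 hk
  congr 1
  omega

/-- `∏ (X ^ a - X ^ (p - a))` over the odd numbers `a < p - 1`, where `p = 2m + 1`. -/
noncomputable def oddProd (R : Type*) [CommRing R] (m : ℕ) : R[X] :=
  ∏ k ∈ Finset.range m, (X ^ (2 * k + 1) - X ^ (2 * m + 1 - (2 * k + 1)))

lemma oddProd_map {R S : Type*} [CommRing R] [CommRing S] (f : R →+* S) (m : ℕ) :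
    (oddProd R m).map f = oddProd S m := by
  simp [oddProd, Polynomial.map_prod]

/-- The square of `oddProd` at a primitive root of unity. -/
lemma oddProd_eval_sq {K : Type*} [Field K] {m : ℕ} {ζ : K}
    (hζ : IsPrimitiveRoot ζ (2 * m + 1)) :
    ((oddProd K m).eval ζ) ^ 2 = (-1) ^ m * (2 * m + 1 : ℕ) := by
  -- Complementary exponents give opposite factors, whence the sign `(-1) ^ m`.
  have h1 : ∏ i ∈ Finset.range (2 * m), (ζ ^ (i + 1) - ζ ^ (2 * m + 1 - (i + 1))) =
      (-1) ^ m * ((oddProd K m).eval ζ) ^ 2 := by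
    rw [prod_range_odd_mul_compl (fun a => ζ ^ a - ζ ^ (2 * m + 1 - a)), oddProd, eval_prod,
      ← Finset.prod_pow]
    conv_rhs => rw [← Finset.card_range m, ← Finset.prod_const, Finset.card_range,
      ← Finset.prod_mul_distrib]
    refine Finset.prod_congr rfl fun k hk => ?_
    have := Finset.mem_range.1 hk
    rw [show 2 * m + 1 - (2 * m + 1 - (2 * k + 1)) = 2 * k + 1 by omega]
    simp
    ring
  -- Multiplying by this trivial product turns each `ζ ^ a - ζ ^ (-a)` into `ζ ^ (2a) - 1`, and `ζ ^
  -- 2` is again a primitive root.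
  have h2 : ∏ i ∈ Finset.range (2 * m), ζ ^ (i + 1) = 1 := by
    rw [prod_range_odd_mul_compl (fun a => ζ ^ a)]
    refine Finset.prod_eq_one fun k hk => ?_
    have := Finset.mem_range.1 hk
    rw [← pow_add, show 2 * k + 1 + (2 * m + 1 - (2 * k + 1)) = 2 * m + 1 by omega,
      hζ.pow_eq_one]
  have hζ2 : IsPrimitiveRoot (ζ ^ 2) (2 * m + 1) :=
    hζ.pow_of_coprime 2 (by simp)
  have h3 := hζ2.prod_one_sub_pow_eq_order
  have h4 : ∏ i ∈ Finset.range (2 * m), (ζ ^ (i + 1) - ζ ^ (2 * m + 1 - (i + 1))) =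
      (2 * m + 1 : ℕ) := by
    rw [← one_mul (∏ i ∈ _, _), ← h2, ← Finset.prod_mul_distrib]
    push_cast at h3 ⊢
    have h5 := Finset.prod_neg (s := Finset.range (2 * m)) (f := fun k => 1 - (ζ ^ 2) ^ (k + 1))
    rw [Finset.card_range, Even.neg_one_pow (by simp), one_mul] at h5
    rw [← h3, ← h5]
    refine Finset.prod_congr rfl fun i hi => ?_
    have := Finset.mem_range.1 hi
    rw [mul_sub, ← pow_add, ← pow_add,
      show i + 1 + (2 * m - i) = 2 * m + 1 by omega, hζ.pow_eq_one, ← pow_mul]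
    ring
  rw [← h4, h1, ← mul_assoc, ← mul_pow]
  simp

lemma exists_X_pow_sub_X_pow_factor {R : Type*} [CommRing R] (a b : ℕ) :
    ∃ g : R[X], X ^ a - X ^ b = (X - 1) * g ∧ g.eval 1 = (a : R) - b := by
  obtain ⟨g, hg⟩ : (X - 1 : R[X]) ∣ X ^ a - X ^ b := by
    rw [← C_1, dvd_iff_isRoot]; simp
  refine ⟨g, hg, ?_⟩
  have := congrArg (fun q => (derivative q).eval 1) hg
  simpa [derivative_mul, derivative_X_pow] using this.symm

lemma prod_four_mul_add_two (R : Type*) [CommRing R] (m : ℕ) :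
    (m.factorial : R) * ∏ k ∈ Finset.range m, ((4 * k + 2 : ℕ) : R) = (2 * m).factorial := by
  induction m with
  | zero => simp
  | succ m ih =>
    rw [Finset.prod_range_succ, show 2 * (m + 1) = 2 * m + 1 + 1 by ring, Nat.factorial_succ,
      Nat.factorial_succ, Nat.factorial_succ, Nat.cast_mul, Nat.cast_mul, Nat.cast_mul, ← ih]
    push_cast
    ring

variable {p : ℕ} [Fact p.Prime]

/-- Each of the `m` factors has a simple zero at 1 with slope `a - (p - a) ≡ 2a = 4k + 2`. The
resulting `m! ∏ (4k + 2)` is `(p - 1)!`, so Wilson's theorem applies. -/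
lemma eval_eulerOp_iterate_oddProd {m : ℕ} (hm : p = 2 * m + 1) :
    (eulerOp^[m] (oddProd (ZMod p) m)).eval 1 = -1 := by
  choose g hg hg1 using fun k : ℕ =>
    exists_X_pow_sub_X_pow_factor (R := ZMod p) (2 * k + 1) (2 * m + 1 - (2 * k + 1))
  have : oddProd (ZMod p) m = (X - 1) ^ m * ∏ k ∈ Finset.range m, g k := by
    rw [oddProd, Finset.prod_congr rfl fun k _ => hg k, Finset.prod_mul_distrib]
    simp
  rw [this, eval_eulerOp_iterate_X_sub_one_pow_mul, eval_prod]
  have h2 : ∏ k ∈ Finset.range m, (g k).eval 1 =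
      ∏ k ∈ Finset.range m, ((4 * k + 2 : ℕ) : ZMod p) := by
    refine Finset.prod_congr rfl fun k hk => ?_
    have := Finset.mem_range.1 hk
    have h0 : ((2 * m + 1 : ℕ) : ZMod p) = 0 := by rw [← hm, CharP.cast_eq_zero]
    rw [hg1, Nat.cast_sub (by omega), h0]
    push_cast
    ring
  rw [h2, prod_four_mul_add_two, show 2 * m = p - 1 by omega, ZMod.wilsons_lemma]

/-- The polynomial `∑ χ(j) X ^ j` attached to the quadratic character. -/
noncomputable def feketePoly (p : ℕ) [Fact p.Prime] : ℤ[X] :=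
  ∑ j : ZMod p, C (quadraticChar (ZMod p) j) * X ^ j.val

/-- By Euler's criterion the coefficient `χ(j)` is `j ^ m`, and the operator supplies another `j ^
m`; the sum counts the nonzero residues. -/
lemma eval_eulerOp_iterate_feketePoly {m : ℕ} (hm : p = 2 * m + 1) (hm0 : m ≠ 0) :
    (eulerOp^[m] ((feketePoly p).map (Int.castRingHom (ZMod p)))).eval 1 = -1 := by
  have hc : ringChar (ZMod p) ≠ 2 := by rw [ZMod.ringChar_zmod_n]; omega
  simp only [feketePoly, Polynomial.map_sum, Polynomial.map_mul, Polynomial.map_pow, map_C, map_X,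
    eulerOp_iterate_sum, eulerOp_iterate_C_mul_X_pow, eval_finsetSum, eval_mul, eval_C, eval_pow,
    eval_X, one_pow, mul_one, ZMod.natCast_val, ZMod.cast_id', id]
  have h (j : ZMod p) : (Int.castRingHom (ZMod p)) (quadraticChar (ZMod p) j) * j ^ m =
      if j = 0 then 0 else 1 := by
    rw [eq_intCast, quadraticChar_eq_pow_of_char_ne_two' hc, ZMod.card, ← pow_add,
      show p / 2 + m = p - 1 by omega]
    split_ifs with hj
    · rw [hj, zero_pow (by omega)]
    · exact ZMod.pow_card_sub_one_eq_one hj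
  rw [Finset.sum_congr rfl fun j _ => h j, Finset.sum_ite]
  simp [Finset.filter_ne', Finset.card_erase_of_mem, ZMod.card,
    Nat.cast_pred (Fact.out : p.Prime).pos]

/-- Kronecker's argument: the Fekete polynomial and the odd product cannot be opposite
at a primitive root of unity. -/
lemma aeval_feketePoly_add_oddProd_ne_zero {m : ℕ} (hm : p = 2 * m + 1) (hm0 : m ≠ 0) {ζ : ℂ}
    (hζ : IsPrimitiveRoot ζ p) : aeval ζ (feketePoly p + oddProd ℤ m) ≠ 0 := by
  intro h0
  have hp : p.Prime := Fact.out
  have hd : cyclotomic p ℤ ∣ feketePoly p + oddProd ℤ m := by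
    rw [cyclotomic_eq_minpoly hζ hp.pos]
    exact minpoly.isIntegrallyClosed_dvd (hζ.isIntegral hp.pos) h0
  have hd2 := Polynomial.map_dvd (Int.castRingHom (ZMod p)) hd
  have hc := cyclotomic_mul_prime_eq_pow_of_not_dvd (ZMod p) hp.not_dvd_one
  rw [one_mul, cyclotomic_one] at hc
  rw [map_cyclotomic, hc,
    Polynomial.map_add, oddProd_map, show p - 1 = m + m by omega, pow_add] at hd2
  obtain ⟨g, hg⟩ := hd2
  have := congrArg (fun q => (eulerOp^[m] q).eval 1) hg
  simp only [mul_assoc, eulerOp_iterate_add, eval_add, eval_eulerOp_iterate_X_sub_one_pow_mul,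
    eval_eulerOp_iterate_oddProd hm, eval_eulerOp_iterate_feketePoly hm hm0] at this
  -- The left side is `-1 - 1`. On the right, `(X - 1) ^ (2m)` still vanishes at 1 after `m`
  -- applications.
  have h2 : (2 : ZMod p) = 0 := by
    simp [hm0] at this
    linear_combination -this
  have := (ZMod.natCast_eq_zero_iff 2 p).1 (by exact_mod_cast h2)
  have := Nat.le_of_dvd (by norm_num) this
  omega

end GaussSign

/-! ### The sign of the Gauss sum -/

section GaussSum
open Polynomial

lemma exp_pow_sub_exp_pow_compl {p a : ℕ} (hp : p ≠ 0) (ha : a ≤ p) :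
    Complex.exp (2 * Real.pi * Complex.I / p) ^ a -
      Complex.exp (2 * Real.pi * Complex.I / p) ^ (p - a) =
      2 * Complex.I * (Real.sin (2 * Real.pi * a / p) : ℝ) := by
  have hp' : (p : ℂ) ≠ 0 := by exact_mod_cast hp
  have h1 : Complex.exp (2 * Real.pi * Complex.I / p) ^ a =
      Complex.exp ((2 * Real.pi * a / p : ℂ) * Complex.I) := by
    rw [← Complex.exp_nat_mul]; congr 1; ring
  have h2 : Complex.exp (2 * Real.pi * Complex.I / p) ^ (p - a) =
      Complex.exp (-(2 * Real.pi * a / p : ℂ) * Complex.I) := by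
    rw [← Complex.exp_nat_mul, Nat.cast_sub ha,
      show ((p : ℂ) - a) * (2 * Real.pi * Complex.I / p) =
        -(2 * Real.pi * a / p : ℂ) * Complex.I + 2 * Real.pi * Complex.I by field_simp; ring,
      Complex.exp_add, Complex.exp_two_pi_mul_I, mul_one]
  rw [h1, h2]
  push_cast
  rw [Complex.sin]
  linear_combination (Complex.exp ((2 * Real.pi * a / p : ℂ) * Complex.I) -
    Complex.exp (-(2 * Real.pi * a / p : ℂ) * Complex.I)) * Complex.I_sq

/-- Each factor is `2i sin(2πa/p)` with `a` odd and `p = 4t + 3`. The `t + 1` sines with `a < p/2`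
are positive and the other `t` negative, and `i ^ (2t + 1) (-1) ^ t = i`. -/
lemma oddProd_eval_exp {t : ℕ} :
    ∃ r : ℝ, 0 < r ∧
      (oddProd ℂ (2 * t + 1)).eval (Complex.exp (2 * Real.pi * Complex.I / (4 * t + 3 : ℕ))) =
        Complex.I * r := by
  set s : ℕ → ℝ := fun k => Real.sin (2 * Real.pi * (2 * k + 1 : ℕ) / (4 * t + 3 : ℕ)) with hs
  have hpi := Real.pi_pos
  have hpos : 0 < ∏ k ∈ Finset.range (t + 1), s k := by
    refine Finset.prod_pos fun k hk => ?_
    have hk : k < t + 1 := Finset.mem_range.1 hk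
    have h2 : (k : ℝ) ≤ t := by exact_mod_cast Nat.lt_succ_iff.1 hk
    apply Real.sin_pos_of_pos_of_lt_pi
    · positivity
    · rw [div_lt_iff₀ (by positivity)]
      push_cast
      nlinarith
  have hneg : 0 < ∏ k ∈ Finset.range t, -s (t + 1 + k) := by
    refine Finset.prod_pos fun k hk => ?_
    have hk : k < t := Finset.mem_range.1 hk
    have h2 : (k : ℝ) + 1 ≤ t := by exact_mod_cast hk
    have h3 : (0 : ℝ) ≤ k := k.cast_nonneg
    have h4 : s (t + 1 + k) = Real.sin (2 * Real.pi * (2 * (t + 1 + k) + 1 : ℕ) / (4 * t + 3 : ℕ)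
        - 2 * Real.pi) := by rw [Real.sin_sub_two_pi]
    rw [h4, neg_pos]
    apply Real.sin_neg_of_neg_of_neg_pi_lt
    · rw [sub_neg, div_lt_iff₀ (by positivity)]
      push_cast
      nlinarith
    · rw [lt_sub_iff_add_lt, lt_div_iff₀ (by positivity)]
      push_cast
      nlinarith
  refine ⟨2 ^ (2 * t + 1) * ((∏ k ∈ Finset.range (t + 1), s k) *
    ∏ k ∈ Finset.range t, -s (t + 1 + k)), by positivity, ?_⟩
  have h1 : (oddProd ℂ (2 * t + 1)).eval
      (Complex.exp (2 * Real.pi * Complex.I / (4 * t + 3 : ℕ))) =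
      ∏ k ∈ Finset.range (2 * t + 1), (2 * Complex.I * (s k : ℂ)) := by
    rw [oddProd, eval_prod]
    refine Finset.prod_congr rfl fun k hk => ?_
    have hk : k < 2 * t + 1 := Finset.mem_range.1 hk
    rw [← exp_pow_sub_exp_pow_compl (by omega) (by omega), eval_sub, eval_pow, eval_pow, eval_X,
      show 2 * (2 * t + 1) + 1 = 4 * t + 3 by ring]
  have hI : Complex.I ^ (2 * t + 1) = (-1) ^ t * Complex.I := by
    rw [pow_succ, pow_mul, Complex.I_sq]
  have hm1 : ((-1 : ℂ) ^ t) * (-1) ^ t = 1 := by rw [← mul_pow]; simp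
  rw [h1, Finset.prod_mul_distrib, Finset.prod_const, Finset.card_range, mul_pow, hI,
    show 2 * t + 1 = t + 1 + t by ring, Finset.prod_range_add, Finset.prod_neg, Finset.card_range]
  push_cast
  ring

variable {p : ℕ} [Fact p.Prime]

/-- The quadratic character with values in `ℂ`. -/
noncomputable def quadCharC (p : ℕ) [Fact p.Prime] : MulChar (ZMod p) ℂ :=
  (quadraticChar (ZMod p)).ringHomComp (Int.castRingHom ℂ)

lemma quadCharC_apply (j : ZMod p) : quadCharC p j = (quadraticChar (ZMod p) j : ℤ) := rfl

lemma quadCharC_isQuadratic : (quadCharC p).IsQuadratic :=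
  (quadraticChar_isQuadratic (ZMod p)).comp _

lemma ringChar_zmod_ne_two (hp : p % 4 = 3) : ringChar (ZMod p) ≠ 2 := by
  rw [ZMod.ringChar_zmod_n]; omega

lemma quadCharC_ne_one (hp : p % 4 = 3) : quadCharC p ≠ 1 :=
  (MulChar.ringHomComp_ne_one_iff (Int.castRingHom ℂ).injective_int).2
    (quadraticChar_ne_one (ringChar_zmod_ne_two hp))

lemma quadraticChar_neg_one_eq (hp : p % 4 = 3) : quadraticChar (ZMod p) (-1) = -1 := by
  rw [quadraticChar_neg_one (ringChar_zmod_ne_two hp), ZMod.card, ZMod.χ₄_nat_three_mod_four hp]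

lemma quadraticChar_neg (hp : p % 4 = 3) (j : ZMod p) :
    quadraticChar (ZMod p) (-j) = -quadraticChar (ZMod p) j := by
  rw [← neg_one_mul, map_mul, quadraticChar_neg_one_eq hp, neg_one_mul]

lemma stdAddChar_eq_exp_pow (j : ZMod p) :
    ZMod.stdAddChar j = Complex.exp (2 * Real.pi * Complex.I / p) ^ j.val := by
  conv_lhs => rw [← ZMod.natCast_zmod_val j]
  rw [← Int.cast_natCast, ZMod.stdAddChar_coe, ← Complex.exp_nat_mul]
  congr 1
  push_cast
  ring

/-- The sign of the quadratic Gauss sum for `p ≡ 3 mod 4`. -/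
theorem gaussSum_quadCharC (hp : p % 4 = 3) :
    gaussSum (quadCharC p) ZMod.stdAddChar = Complex.I * (Real.sqrt p : ℝ) := by
  have hpp : p.Prime := Fact.out
  obtain ⟨t, ht⟩ : ∃ t, p = 4 * t + 3 := ⟨p / 4, by omega⟩
  set ζ := Complex.exp (2 * Real.pi * Complex.I / p) with hζdef
  have hζ : IsPrimitiveRoot ζ p := Complex.isPrimitiveRoot_exp p hpp.ne_zero
  have hG : gaussSum (quadCharC p) ZMod.stdAddChar = aeval ζ (feketePoly p) := by
    rw [gaussSum, feketePoly, map_sum]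
    refine Finset.sum_congr rfl fun j _ => ?_
    rw [stdAddChar_eq_exp_pow, quadCharC_apply]
    simp [hζdef]
  have hB : aeval ζ (oddProd ℤ (2 * t + 1)) = (oddProd ℂ (2 * t + 1)).eval ζ := by
    rw [← oddProd_map (Int.castRingHom ℂ), eval_map, aeval_def]; rfl
  have hG2 := gaussSum_sq (χ := quadCharC p) (quadCharC_ne_one hp) quadCharC_isQuadratic
    (ZMod.isPrimitive_stdAddChar p)
  rw [quadCharC_apply, quadraticChar_neg_one_eq hp, ZMod.card] at hG2
  have hB2 := oddProd_eval_sq (m := 2 * t + 1)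
    (by rwa [show 2 * (2 * t + 1) + 1 = p by omega] : IsPrimitiveRoot ζ _)
  rw [show 2 * (2 * t + 1) + 1 = p by omega, Odd.neg_one_pow (by simp)] at hB2
  have hne := aeval_feketePoly_add_oddProd_ne_zero (p := p) (m := 2 * t + 1) (by omega)
    (by omega) hζ
  rw [map_add, hB, ← hG] at hne
  have hGB : gaussSum (quadCharC p) ZMod.stdAddChar = (oddProd ℂ (2 * t + 1)).eval ζ := by
    rcases sq_eq_sq_iff_eq_or_eq_neg.1 (hG2.trans (by rw [hB2]; simp)) with h | h
    · exact h
    · exact absurd (by rw [h, neg_add_cancel]) hne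
  obtain ⟨r, hr, hr2⟩ := oddProd_eval_exp (t := t)
  rw [← ht] at hr2
  rw [hGB, hr2]
  rw [hr2, mul_pow, Complex.I_sq] at hB2
  have : r ^ 2 = p := by
    have h : (r : ℂ) ^ 2 = p := by linear_combination -hB2
    exact_mod_cast h
  rw [← this, Real.sqrt_sq hr.le]

end GaussSum

/-! ### The odd Hurwitz zeta function at 1 -/

section HurwitzOdd
open Filter Topology HurwitzZeta

/-- The difference is `a ^ (-s) (1 - (a/b) ^ s)`, and both factors are `O(1/n)` uniformly for `1 ≤ s
≤ 2`. -/
lemma one_div_rpow_sub_le {u a b s : ℝ} {n : ℕ} (hu : 0 < u) (hu1 : u ≤ 1)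
    (ha : u * (n + 1) ≤ a) (hab : a ≤ b) (hb : b ≤ a + 1) (hs1 : 1 ≤ s) (hs2 : s ≤ 2) :
    |1 / a ^ s - 1 / b ^ s| ≤ 2 / u ^ 3 * (1 / ((n : ℝ) + 1) ^ 2) := by
  have hn : (1 : ℝ) ≤ n + 1 := by simp
  have ha0 : 0 < a := lt_of_lt_of_le (by positivity) ha
  have hb0 : 0 < b := lt_of_lt_of_le ha0 hab
  have hmono : a ^ s ≤ b ^ s := Real.rpow_le_rpow ha0.le hab (by linarith)
  have has : 0 < a ^ s := Real.rpow_pos_of_pos ha0 s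
  rw [abs_of_nonneg (sub_nonneg.2 (one_div_le_one_div_of_le has hmono))]
  have h1 : 1 / a ^ s - 1 / b ^ s = 1 / a ^ s * (1 - (a / b) ^ s) := by
    rw [Real.div_rpow ha0.le hb0.le]; field_simp
  have h2 : 1 - (a / b) ^ s ≤ 2 / (u * (n + 1)) := by
    have hab1 : a / b ≤ 1 := (div_le_one hb0).2 hab
    have h3 : (a / b) ^ (2 : ℝ) ≤ (a / b) ^ s :=
      Real.rpow_le_rpow_of_exponent_ge (div_pos ha0 hb0) hab1 hs2
    rw [Real.rpow_two] at h3
    have h4 : 1 - a / b ≤ 1 / (u * (n + 1)) := by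
      rw [one_sub_div hb0.ne']
      exact div_le_div₀ zero_le_one (by linarith) (by positivity) (ha.trans hab)
    have h5 : 2 / (u * (n + 1)) = 2 * (1 / (u * (n + 1))) := by ring
    rw [h5]
    nlinarith [sq_nonneg (1 - a / b)]
  have h3 : 1 / a ^ s ≤ 1 / (u ^ 2 * (n + 1)) := by
    refine one_div_le_one_div_of_le (by positivity) ?_
    calc u ^ 2 * ((n : ℝ) + 1) = u ^ (2 : ℝ) * (n + 1) ^ (1 : ℝ) := by simp
      _ ≤ u ^ s * (n + 1) ^ s := by
          gcongr ?_ * ?_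
          · exact Real.rpow_le_rpow_of_exponent_ge hu hu1 hs2
          · exact Real.rpow_le_rpow_of_exponent_le hn hs1
      _ = (u * (n + 1)) ^ s := (Real.mul_rpow hu.le (by positivity)).symm
      _ ≤ a ^ s := Real.rpow_le_rpow (by positivity) ha (by linarith)
  have h6 : 0 ≤ 1 - (a / b) ^ s :=
    sub_nonneg.2 (Real.rpow_le_one (by positivity) ((div_le_one hb0).2 hab) (by linarith))
  calc 1 / a ^ s - 1 / b ^ s = 1 / a ^ s * (1 - (a / b) ^ s) := h1
    _ ≤ 1 / (u ^ 2 * (n + 1)) * (2 / (u * (n + 1))) := by gcongr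
    _ = _ := by field_simp

/-- A bound for the terms of the odd Hurwitz zeta series, uniform in `1 ≤ s ≤ 2`. -/
lemma exists_bound_hurwitz_odd_term {x : ℝ} (hx0 : 0 < x) (hx1 : x < 1) :
    ∃ K : ℝ, ∀ s : ℝ, 1 ≤ s → s ≤ 2 → ∀ n : ℕ,
      |(1 / ((n : ℝ) + x) ^ s - 1 / ((n : ℝ) + 1 - x) ^ s) / 2| ≤ K * (1 / ((n : ℝ) + 1) ^ 2) := by
  refine ⟨2 / (min x (1 - x)) ^ 3, fun s hs1 hs2 n => ?_⟩
  set u := min x (1 - x) with hu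
  have hu0 : 0 < u := lt_min hx0 (by linarith)
  have hux : u ≤ x := min_le_left _ _
  have hux' : u ≤ 1 - x := min_le_right _ _
  have hn : (0 : ℝ) ≤ n := n.cast_nonneg
  have key : |1 / ((n : ℝ) + x) ^ s - 1 / ((n : ℝ) + 1 - x) ^ s| ≤
      2 / u ^ 3 * (1 / ((n : ℝ) + 1) ^ 2) := by
    rcases le_total ((n : ℝ) + x) ((n : ℝ) + 1 - x) with h | h
    · exact one_div_rpow_sub_le hu0 (by linarith) (by nlinarith) h (by linarith) hs1 hs2
    · rw [abs_sub_comm]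
      exact one_div_rpow_sub_le hu0 (by linarith) (by nlinarith) h (by linarith) hs1 hs2
  rw [abs_div, abs_of_pos (two_pos : (0 : ℝ) < 2)]
  exact (half_le_self (abs_nonneg _)).trans key

lemma summable_const_mul_one_div_succ_sq (K : ℝ) :
    Summable fun n : ℕ => K * (1 / ((n : ℝ) + 1) ^ 2) := by
  refine Summable.mul_left K ?_
  have := (summable_nat_add_iff 1).2 (Real.summable_one_div_nat_pow.2 one_lt_two)
  simpa using this

/-- The series represents the function for `s > 1`; dominated convergence on one side and continuity
on the other allow `s → 1⁺`. -/
lemma hurwitzZetaOdd_one_eq_tsum {x : ℝ} (hx0 : 0 < x) (hx1 : x < 1) :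
    hurwitzZetaOdd (x : UnitAddCircle) 1 =
      ((∑' n : ℕ, (1 / ((n : ℝ) + x) - 1 / ((n : ℝ) + 1 - x)) / 2 : ℝ) : ℂ) := by
  obtain ⟨K, hK⟩ := exists_bound_hurwitz_odd_term hx0 hx1
  have h1 : Tendsto (fun s : ℝ =>
      ∑' n : ℕ, (1 / ((n : ℝ) + x) ^ s - 1 / ((n : ℝ) + 1 - x) ^ s) / 2) (𝓝[>] 1)
      (𝓝 (∑' n : ℕ, (1 / ((n : ℝ) + x) - 1 / ((n : ℝ) + 1 - x)) / 2)) := by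
    refine tendsto_tsum_of_dominated_convergence (summable_const_mul_one_div_succ_sq K)
      (fun n => ?_) ?_
    · have hn : (0 : ℝ) ≤ n := n.cast_nonneg
      have ha : 0 < (n : ℝ) + x := by linarith
      have hb : 0 < (n : ℝ) + 1 - x := by linarith
      have hc : ContinuousAt (fun s : ℝ =>
          (1 / ((n : ℝ) + x) ^ s - 1 / ((n : ℝ) + 1 - x) ^ s) / 2) 1 := by
        refine ((continuousAt_const.div (Real.continuousAt_const_rpow ha.ne')
          (Real.rpow_pos_of_pos ha _).ne').sub (continuousAt_const.div
          (Real.continuousAt_const_rpow hb.ne') (Real.rpow_pos_of_pos hb _).ne')).div_const 2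
      have := hc.tendsto.mono_left (nhdsWithin_le_nhds (s := Set.Ioi 1))
      simpa only [Real.rpow_one] using this
    · filter_upwards [Ioo_mem_nhdsGT (show (1 : ℝ) < 2 by norm_num)] with s hs n
      exact hK s hs.1.le hs.2.le n
  have h2 : Tendsto (fun s : ℝ => hurwitzZetaOdd (x : UnitAddCircle) (s : ℂ)) (𝓝[>] 1)
      (𝓝 (hurwitzZetaOdd (x : UnitAddCircle) 1)) := by
    have hc : Continuous fun s : ℝ => hurwitzZetaOdd (x : UnitAddCircle) (s : ℂ) :=
      (differentiable_hurwitzZetaOdd _).continuous.comp Complex.continuous_ofReal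
    simpa using (hc.tendsto 1).mono_left (nhdsWithin_le_nhds (s := Set.Ioi 1))
  refine tendsto_nhds_unique h2 (((Complex.continuous_ofReal.tendsto _).comp h1).congr' ?_)
  filter_upwards [self_mem_nhdsWithin] with s hs
  have hs : 1 < s := hs
  rw [← (hasSum_nat_hurwitzZetaOdd_of_mem_Icc ⟨hx0.le, hx1.le⟩
    (s := (s : ℂ)) (by simpa using hs)).tsum_eq, Function.comp_apply, Complex.ofReal_tsum]
  refine tsum_congr fun n => ?_
  have hn : (0 : ℝ) ≤ n := n.cast_nonneg
  push_cast
  rw [Complex.ofReal_cpow (by linarith), Complex.ofReal_cpow (by linarith)]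
  push_cast
  rfl

lemma tsum_one_div_sub_one_div_eq_cot {x : ℝ} (hx0 : 0 < x) (hx1 : x < 1) :
    ∑' n : ℕ, (1 / ((n : ℝ) + x) - 1 / ((n : ℝ) + 1 - x)) / 2 =
      Real.pi / 2 * Real.cot (Real.pi * x) := by
  obtain ⟨K, hK⟩ := exists_bound_hurwitz_odd_term hx0 hx1
  have hsum : Summable fun n : ℕ => (1 / ((n : ℝ) + x) - 1 / ((n : ℝ) + 1 - x)) / 2 := by
    refine Summable.of_norm_bounded (summable_const_mul_one_div_succ_sq K) fun n => ?_
    simpa only [Real.rpow_one, Real.norm_eq_abs] using hK 1 le_rfl one_le_two n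
  have hxZ : (x : ℂ) ∈ Complex.integerComplement := by
    rintro ⟨k, hk⟩
    have hk : (k : ℝ) = x := by exact_mod_cast hk
    rw [← hk] at hx0 hx1
    have h1 : (0 : ℤ) < k := by exact_mod_cast hx0
    have h2 : k < (1 : ℤ) := by exact_mod_cast hx1
    omega
  have ht := tendsto_logDeriv_euler_cot_sub hxZ
  have ht2 : Tendsto (fun N : ℕ => ∑ j ∈ Finset.range N,
      (1 / (x - ((j : ℝ) + 1)) + 1 / (x + ((j : ℝ) + 1)))) atTop
      (𝓝 (Real.pi * Real.cot (Real.pi * x) - 1 / x)) := by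
    have h := (Complex.continuous_re.tendsto _).comp ht
    have e1 : (Real.pi * Complex.cot (Real.pi * x) - 1 / x : ℂ) =
        ((Real.pi * Real.cot (Real.pi * x) - 1 / x : ℝ) : ℂ) := by push_cast; rfl
    rw [e1, Complex.ofReal_re] at h
    refine h.congr fun N => ?_
    have e2 : ∑ j ∈ Finset.range N, cotTerm (x : ℂ) j = ((∑ j ∈ Finset.range N,
      (1 / (x - ((j : ℝ) + 1)) + 1 / (x + ((j : ℝ) + 1))) : ℝ) : ℂ) := by
      push_cast; rfl
    rw [Function.comp_apply, e2, Complex.ofReal_re]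
  -- Euler's partial fractions pair the terms with an index shift, leaving the boundary term `1 / (N
  -- + x)`.
  have e3 (N : ℕ) : ∑ n ∈ Finset.range N, (1 / ((n : ℝ) + x) - 1 / ((n : ℝ) + 1 - x)) / 2 =
      (1 / x + ∑ j ∈ Finset.range N, (1 / (x - ((j : ℝ) + 1)) + 1 / (x + ((j : ℝ) + 1)))
        - 1 / ((N : ℝ) + x)) / 2 := by
    induction N with
    | zero => simp
    | succ N ih =>
      have hN : (0 : ℝ) ≤ N := N.cast_nonneg
      rw [Finset.sum_range_succ, Finset.sum_range_succ, ih,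
        show x - ((N : ℝ) + 1) = -((N : ℝ) + 1 - x) by ring, one_div_neg_eq_neg_one_div,
        show x + ((N : ℝ) + 1) = ((N + 1 : ℕ) : ℝ) + x by push_cast; ring]
      ring
  have h0 : Tendsto (fun N : ℕ => 1 / ((N : ℝ) + x)) atTop (𝓝 0) :=
    tendsto_const_nhds.div_atTop
      (tendsto_atTop_add_const_right _ _ tendsto_natCast_atTop_atTop)
  have h4 := ((((ht2.const_add (1 / x)).sub h0).div_const 2).congr fun N => (e3 N).symm)
  rw [tendsto_nhds_unique hsum.hasSum.tendsto_sum_nat h4]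
  ring

/-- The value of the odd Hurwitz zeta function at `s = 1`. -/
theorem hurwitzZetaOdd_one {x : ℝ} (hx0 : 0 < x) (hx1 : x < 1) :
    hurwitzZetaOdd (x : UnitAddCircle) 1 = ((Real.pi / 2 * Real.cot (Real.pi * x) : ℝ) : ℂ) := by
  rw [hurwitzZetaOdd_one_eq_tsum hx0 hx1, tsum_one_div_sub_one_div_eq_cot hx0 hx1]

end HurwitzOdd

/-! ### Positivity of `L(1, χ)` -/

section Positivity
open Filter Topology HurwitzZeta
open scoped ComplexOrder

variable {p : ℕ} [Fact p.Prime]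

/-- Every Euler factor `(1 - χ(q) q ^ (-s))⁻¹` is nonnegative, since `χ(q) ≤ 1` and `q ^ (-s) ≤ 1`.
-/
lemma LSeries_quadCharC_nonneg {s : ℝ} (hs : 1 < s) :
    0 ≤ LSeries (fun n => quadCharC p n) (s : ℂ) := by
  have h := DirichletCharacter.LSeries_eulerProduct_hasProd (s := (s : ℂ)) (N := p) (quadCharC p)
    (by simpa using hs)
  refine ge_of_tendsto' h fun t => Finset.prod_nonneg fun q _ => ?_
  have hq : (1 : ℝ) < (q : ℕ) := by exact_mod_cast q.2.one_lt
  have e : (1 - quadCharC p ((q : ℕ) : ZMod p) * ((q : ℕ) : ℂ) ^ (-(s : ℂ)))⁻¹ =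
      (((1 - (quadraticChar (ZMod p) ((q : ℕ) : ZMod p) : ℝ) * ((q : ℕ) : ℝ) ^ (-s))⁻¹ : ℝ) : ℂ) := by
    rw [quadCharC_apply]
    push_cast
    rw [Complex.ofReal_cpow (by positivity)]
    push_cast
    rfl
  rw [e, Complex.zero_le_real, inv_nonneg, sub_nonneg]
  have h1 : ((q : ℕ) : ℝ) ^ (-s) ≤ 1 := Real.rpow_le_one_of_one_le_of_nonpos hq.le (by linarith)
  have h2 : 0 ≤ ((q : ℕ) : ℝ) ^ (-s) := by positivity
  rcases quadraticChar_isQuadratic (ZMod p) ((q : ℕ) : ZMod p) with h | h | h <;> rw [h] <;>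
    push_cast <;> linarith

lemma LFunction_quadCharC_one_nonneg (hp : p % 4 = 3) :
    0 ≤ DirichletCharacter.LFunction (N := p) (quadCharC p) 1 := by
  have hc : Continuous fun s : ℝ => DirichletCharacter.LFunction (N := p) (quadCharC p) (s : ℂ) :=
    (DirichletCharacter.differentiable_LFunction (quadCharC_ne_one hp)).continuous.comp
      Complex.continuous_ofReal
  have ht := (hc.tendsto 1).mono_left (nhdsWithin_le_nhds (s := Set.Ioi 1))
  rw [Complex.ofReal_one] at ht
  refine ge_of_tendsto ht ?_
  filter_upwards [self_mem_nhdsWithin] with s hs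
  have hs : 1 < s := hs
  rw [DirichletCharacter.LFunction_eq_LSeries _ (by simpa using hs)]
  exact LSeries_quadCharC_nonneg hs

/-- The cotangent function on residues mod `p`. -/
noncomputable def cotRes (p : ℕ) (k : ZMod p) : ℝ := Real.cot (Real.pi * k.val / p)

lemma LFunction_quadCharC_one_eq (hp : p % 4 = 3) :
    DirichletCharacter.LFunction (N := p) (quadCharC p) 1 =
      ((Real.pi / (2 * p) * ∑ k : ZMod p, (quadraticChar (ZMod p) k : ℝ) * cotRes p k : ℝ) : ℂ) := by
  have hodd : Function.Odd (quadCharC p : ZMod p → ℂ) := fun j => by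
    rw [quadCharC_apply, quadCharC_apply, quadraticChar_neg hp]; push_cast; rfl
  have hp0 : (0 : ℝ) < p := by exact_mod_cast (Fact.out : p.Prime).pos
  rw [DirichletCharacter.LFunction, ZMod.LFunction_def_odd hodd, Complex.cpow_neg_one]
  push_cast
  rw [Finset.mul_sum, Finset.mul_sum]
  refine Finset.sum_congr rfl fun j _ => ?_
  rw [quadCharC_apply]
  rcases eq_or_ne j 0 with rfl | hj
  · simp
  · have hv : 0 < j.val := Nat.pos_of_ne_zero fun h => hj ((ZMod.val_eq_zero j).1 h)
    have hv0 : (0 : ℝ) < (j.val : ℝ) / p := by positivity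
    have hv1 : (j.val : ℝ) / p < 1 := by
      rw [div_lt_one hp0]; exact_mod_cast ZMod.val_lt j
    rw [ZMod.toAddCircle_apply, hurwitzZetaOdd_one hv0 hv1, cotRes, mul_div_assoc]
    push_cast
    field_simp

theorem sum_quadraticChar_mul_cotRes_pos (hp : p % 4 = 3) :
    0 < ∑ k : ZMod p, (quadraticChar (ZMod p) k : ℝ) * cotRes p k := by
  have hp0 : (0 : ℝ) < p := by exact_mod_cast (Fact.out : p.Prime).pos
  have h1 := LFunction_quadCharC_one_nonneg hp
  have h2 := DirichletCharacter.LFunction_apply_one_ne_zero (N := p) (quadCharC_ne_one hp)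
  have h3 := lt_of_le_of_ne h1 h2.symm
  rw [LFunction_quadCharC_one_eq hp, Complex.zero_lt_real] at h3
  exact pos_of_mul_pos_right h3 (by positivity)

end Positivity

/-! ### Character sums over squares -/

section Sums

variable {p : ℕ} [Fact p.Prime]

lemma sum_zmod_eq_sum_range {M : Type*} [AddCommMonoid M] (g : ZMod p → M) :
    ∑ x, g x = ∑ n ∈ Finset.range p, g (n : ZMod p) := by
  refine Finset.sum_bij' (fun x _ => x.val) (fun n _ => (n : ZMod p)) ?_ ?_ ?_ ?_ ?_
  · exact fun x _ => Finset.mem_range.2 (ZMod.val_lt x)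
  · exact fun _ _ => Finset.mem_univ _
  · exact fun x _ => ZMod.natCast_zmod_val x
  · exact fun n hn => ZMod.val_cast_of_lt (Finset.mem_range.1 hn)
  · exact fun x _ => by rw [ZMod.natCast_zmod_val]

lemma sum_Icc_one_eq_sum_range {M : Type*} [AddCommMonoid M] (g : ℕ → M) (m : ℕ) :
    ∑ n ∈ Finset.Icc 1 m, g n = ∑ n ∈ Finset.range m, g (n + 1) := by
  rw [← Finset.Ico_add_one_right_eq_Icc, Finset.sum_Ico_eq_sum_range]
  exact Finset.sum_congr rfl fun n _ => by rw [add_comm]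

lemma sum_zmod_of_even {m : ℕ} (hm : p = 2 * m + 1) {g : ZMod p → ℝ} (hg : Function.Even g) :
    ∑ x, g x = g 0 + 2 * ∑ n ∈ Finset.Icc 1 m, g (n : ZMod p) := by
  rw [sum_zmod_eq_sum_range, sum_Icc_one_eq_sum_range (fun n => g (n : ZMod p)),
    Finset.sum_congr (congrArg Finset.range hm) fun _ _ => rfl, Finset.sum_range_succ', two_mul m,
    Finset.sum_range_add, ← Finset.sum_range_reflect (fun n => g ((m + n + 1 : ℕ) : ZMod p))]
  have : ∀ n ∈ Finset.range m, g ((m + (m - 1 - n) + 1 : ℕ) : ZMod p) =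
      g ((n + 1 : ℕ) : ZMod p) := by
    intro n hn
    have := Finset.mem_range.1 hn
    rw [← hg, show m + (m - 1 - n) + 1 = p - (n + 1) by omega, Nat.cast_sub (by omega),
      CharP.cast_eq_zero, zero_sub, neg_neg]
  rw [Finset.sum_congr rfl this]
  simp
  ring

lemma sum_eq_zero_of_odd {g : ZMod p → ℝ} (hg : Function.Odd g) : ∑ x, g x = 0 := by
  have h : ∑ x, g (-x) = ∑ x, g x := Fintype.sum_equiv (Equiv.neg _) _ _ fun _ => rfl
  simp only [hg _, Finset.sum_neg_distrib] at h
  linarith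

/-- Each `k` has `χ(k) + 1` square roots. -/
lemma sum_comp_sq (hp : p % 4 = 3) (f : ZMod p → ℝ) :
    ∑ x : ZMod p, f (x ^ 2) = ∑ k, ((quadraticChar (ZMod p) k : ℝ) + 1) * f k := by
  classical
  rw [← Finset.sum_fiberwise_of_maps_to (t := Finset.univ) (g := fun x : ZMod p => x ^ 2)
    (fun _ _ => Finset.mem_univ _)]
  refine Finset.sum_congr rfl fun k _ => ?_
  have h := quadraticChar_card_sqrts (ringChar_zmod_ne_two hp) k
  have h' : (({x : ZMod p | x ^ 2 = k}.toFinset.card : ℤ) : ℝ) =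
      (quadraticChar (ZMod p) k : ℝ) + 1 := by rw [h]; push_cast; rfl
  rw [← h', Finset.sum_congr rfl (g := fun _ => f k)
    (fun x hx => by rw [(Finset.mem_filter.1 hx).2]), Finset.sum_const, nsmul_eq_mul]
  congr 2
  congr 1
  ext x
  simp

/-- Half of a character sum of an odd function is its sum over the nonzero squares. -/
lemma two_mul_sum_sq (hp : p % 4 = 3) {f : ZMod p → ℝ} (hf : Function.Odd f) :
    2 * ∑ n ∈ Finset.Icc 1 ((p - 1) / 2), f ((n : ZMod p) ^ 2) =
      ∑ k, (quadraticChar (ZMod p) k : ℝ) * f k := by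
  have h1 := sum_zmod_of_even (p := p) (m := (p - 1) / 2) (by omega)
    (g := fun x => f (x ^ 2)) (fun x => by simp)
  have h0 : f 0 = 0 := by have := hf 0; rw [neg_zero] at this; linarith
  simp only [add_mul, one_mul, sum_comp_sq hp, Finset.sum_add_distrib, sum_eq_zero_of_odd hf,
    ne_eq, OfNat.ofNat_ne_zero, not_false_eq_true, zero_pow, h0] at h1
  linarith

lemma sum_quadraticChar_mul_comp_two_mul (hp : p % 4 = 3) (f : ZMod p → ℝ) :
    ∑ k, (quadraticChar (ZMod p) k : ℝ) * f (2 * k) =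
      (quadraticChar (ZMod p) 2 : ℝ) * ∑ k, (quadraticChar (ZMod p) k : ℝ) * f k := by
  have h2 : (2 : ZMod p) ≠ 0 := Ring.two_ne_zero (ringChar_zmod_ne_two hp)
  have h3 : ∑ k, (quadraticChar (ZMod p) (2 * k) : ℝ) * f (2 * k) =
      ∑ k, (quadraticChar (ZMod p) k : ℝ) * f k :=
    Fintype.sum_equiv (Equiv.mulLeft₀ 2 h2) _ _ fun _ => rfl
  rw [← h3, Finset.mul_sum]
  refine Finset.sum_congr rfl fun k _ => ?_
  have : (quadraticChar (ZMod p) 2 : ℝ) * (quadraticChar (ZMod p) 2 : ℝ) = 1 := by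
    have := quadraticChar_sq_one h2
    rw [sq] at this
    exact_mod_cast this
  rw [map_mul, Int.cast_mul]
  linear_combination (-(quadraticChar (ZMod p) k : ℝ) * f (2 * k)) * this

lemma quadraticChar_two_eq_neg_one (hp : p % 8 = 3) : quadraticChar (ZMod p) 2 = -1 := by
  rw [quadraticChar_two (ringChar_zmod_ne_two (by omega)), ZMod.card,
    ZMod.χ₈_nat_eq_if_mod_eight, if_neg (by omega), if_neg (by omega)]

end Sums

/-! ### Tangent and cotangent sums -/

section Cot

lemma Real.cot_add_nat_mul_pi (y : ℝ) (q : ℕ) : Real.cot (y + q * Real.pi) = Real.cot y := by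
  rw [Real.cot_eq_cos_div_sin, Real.cot_eq_cos_div_sin, Real.cos_add_nat_mul_pi,
    Real.sin_add_nat_mul_pi, mul_div_mul_left _ _ (by simp)]

lemma Real.tan_eq_cot_sub_two_mul_cot (y : ℝ) :
    Real.tan y = Real.cot y - 2 * Real.cot (2 * y) := by
  rw [Real.cot_eq_cos_div_sin, Real.cot_eq_cos_div_sin, Real.tan_eq_sin_div_cos,
    Real.sin_two_mul, Real.cos_two_mul']
  -- At zeros of `sin` or `cos` all three terms are 0, by the convention for division by zero.
  rcases eq_or_ne (Real.sin y) 0 with hs | hs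
  · simp [hs]
  rcases eq_or_ne (Real.cos y) 0 with hc | hc
  · simp [hc]
  field_simp
  ring

variable {p : ℕ} [Fact p.Prime]

lemma cotRes_natCast (a : ℕ) : cotRes p (a : ZMod p) = Real.cot (Real.pi * a / p) := by
  have hp : (p : ℝ) ≠ 0 := by exact_mod_cast (Fact.out : p.Prime).ne_zero
  have h : (a : ℝ) = (a % p : ℕ) + (p : ℝ) * (a / p : ℕ) := by
    exact_mod_cast (Nat.mod_add_div a p).symm
  rw [cotRes, ZMod.val_natCast, ← Real.cot_add_nat_mul_pi _ (a / p)]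
  congr 1
  rw [h]
  field_simp

lemma cotRes_odd : Function.Odd (cotRes p) := by
  intro k
  have hp : (p : ℝ) ≠ 0 := by exact_mod_cast (Fact.out : p.Prime).ne_zero
  rcases eq_or_ne k 0 with rfl | hk
  · simp [cotRes, Real.cot_eq_cos_div_sin]
  · rw [cotRes, ZMod.neg_val, if_neg hk, Nat.cast_sub (ZMod.val_lt k).le, mul_sub, sub_div,
      mul_div_cancel_right₀ _ hp, Real.cot_eq_cos_div_sin, Real.cos_pi_sub, Real.sin_pi_sub,
      neg_div, ← Real.cot_eq_cos_div_sin, cotRes]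

lemma two_mul_cotSum (hp : p % 4 = 3) :
    2 * cotSum p =
      Real.sqrt p * ∑ k : ZMod p, (quadraticChar (ZMod p) k : ℝ) * cotRes p k := by
  rw [← two_mul_sum_sq hp cotRes_odd, cotSum, mul_left_comm]
  congr 2
  refine Finset.sum_congr rfl fun n _ => ?_
  rw [← Nat.cast_pow, ← Nat.cast_pow, cotRes_natCast]

lemma tanSum_eq (hp : p % 4 = 3) :
    tanSum p = (1 - 2 * (quadraticChar (ZMod p) 2 : ℝ)) * cotSum p := by
  have hodd : Function.Odd fun k : ZMod p => cotRes p (2 * k) := fun k => by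
    simp only [mul_neg, cotRes_odd _]
  have h2 := two_mul_sum_sq hp hodd
  have h3 := sum_quadraticChar_mul_comp_two_mul hp (cotRes p)
  have h4 : tanSum p = cotSum p - 2 * (Real.sqrt p *
      ∑ n ∈ Finset.Icc 1 ((p - 1) / 2), cotRes p (2 * (n : ZMod p) ^ 2)) := by
    rw [tanSum, cotSum, mul_left_comm, ← mul_sub]
    congr 1
    rw [Finset.mul_sum, ← Finset.sum_sub_distrib]
    refine Finset.sum_congr rfl fun n _ => ?_
    have : (2 * (n : ZMod p) ^ 2) = ((2 * n ^ 2 : ℕ) : ZMod p) := by push_cast; rfl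
    rw [this, cotRes_natCast, Real.tan_eq_cot_sub_two_mul_cot]
    push_cast
    ring_nf
  have h5 := two_mul_cotSum hp
  rw [h4]
  linear_combination -Real.sqrt p * (h2.trans h3) + (quadraticChar (ZMod p) 2 : ℝ) * h5

end Cot

/-! ### The cotangent sum as a first moment -/

section FirstMoment

lemma sub_one_mul_sum_mul_pow {R : Type*} [CommRing R] (z : R) (n : ℕ) :
    (z - 1) * ∑ j ∈ Finset.range n, (j : R) * z ^ j =
      n * z ^ n - z * ∑ j ∈ Finset.range n, z ^ j := by
  induction n with
  | zero => simp
  | succ n ih =>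
    rw [Finset.sum_range_succ, mul_add, ih, Finset.sum_range_succ]
    push_cast
    ring

variable {p : ℕ} [Fact p.Prime]

/-- The first moment `∑ j χ(j)` of the quadratic character. -/
noncomputable def charMoment (p : ℕ) [Fact p.Prime] : ℤ :=
  ∑ j : ZMod p, quadraticChar (ZMod p) j * (j.val : ℤ)

lemma sum_val_mul_stdAddChar {k : ZMod p} (hk : k ≠ 0) :
    (ZMod.stdAddChar k - 1) * ∑ j : ZMod p, (j.val : ℂ) * ZMod.stdAddChar (j * k) = p := by
  set z : ℂ := ZMod.stdAddChar k with hz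
  have hz1 : z - 1 ≠ 0 := by
    rw [sub_ne_zero, hz, ← AddChar.map_zero_eq_one (ZMod.stdAddChar (N := p))]
    exact fun h => hk (ZMod.injective_stdAddChar h)
  have hpow (n : ℕ) : (ZMod.stdAddChar ((n : ZMod p) * k) : ℂ) = z ^ n := by
    rw [← nsmul_eq_mul, AddChar.map_nsmul_eq_pow]
  have hzp : z ^ p = 1 := by rw [← hpow]; simp
  have h0 : ∑ j ∈ Finset.range p, z ^ j = 0 := by
    have := geom_sum_mul z p
    rw [hzp, sub_self] at this
    exact (mul_eq_zero.1 this).resolve_right hz1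
  have h1 : ∑ j : ZMod p, (j.val : ℂ) * ZMod.stdAddChar (j * k) =
      ∑ j ∈ Finset.range p, (j : ℂ) * z ^ j := by
    rw [sum_zmod_eq_sum_range]
    refine Finset.sum_congr rfl fun j hj => ?_
    rw [ZMod.val_cast_of_lt (Finset.mem_range.1 hj), hpow]
  rw [h1, sub_one_mul_sum_mul_pow, hzp, h0]
  simp

/-- The finite Fourier expansion of the cotangent. -/
lemma cotRes_eq_sum {k : ZMod p} (hk : k ≠ 0) :
    (cotRes p k : ℂ) =
      Complex.I * (1 + 2 / p * ∑ j : ZMod p, (j.val : ℂ) * ZMod.stdAddChar (j * k)) := by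
  have hp : (p : ℂ) ≠ 0 := by exact_mod_cast (Fact.out : p.Prime).ne_zero
  have h := sum_val_mul_stdAddChar hk
  have hne : (ZMod.stdAddChar k : ℂ) - 1 ≠ 0 := fun h0 => by
    rw [h0, zero_mul] at h; exact hp h.symm
  have hne' : 1 - (ZMod.stdAddChar k : ℂ) ≠ 0 := by
    rw [← neg_sub]; exact neg_ne_zero.2 hne
  have he : Complex.exp (2 * Real.pi * Complex.I * (k.val / p)) = ZMod.stdAddChar k := by
    rw [stdAddChar_eq_exp_pow, ← Complex.exp_nat_mul]; congr 1; ring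
  rw [cotRes, mul_div_assoc, Complex.ofReal_cot]
  push_cast
  -- With `z = exp(2πik/p)`, `cot(πk/p) = i (1 + 2/(z - 1))`, and `∑ j z ^ j = p/(z - 1)`.
  rw [Complex.cot_pi_eq_exp_ratio, he, div_eq_iff (mul_ne_zero Complex.I_ne_zero hne')]
  generalize ∑ j : ZMod p, (j.val : ℂ) * ZMod.stdAddChar (j * k) = T at h
  have h' : 2 / (p : ℂ) * T * (1 - ZMod.stdAddChar k) = -2 := by
    rw [div_mul_eq_mul_div, div_mul_eq_mul_div, div_eq_iff hp]; linear_combination -2 * h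
  linear_combination (-(1 - (ZMod.stdAddChar k : ℂ)) + 2) * Complex.I_sq -
    Complex.I ^ 2 * h'

/-- The constant term of the Fourier expansion dies because `∑ χ = 0`. After exchanging sums the
inner one is `χ(j) i√p`, and `i · i` gives the minus sign. -/
lemma sum_quadraticChar_mul_cotRes (hp : p % 4 = 3) :
    Real.sqrt p * ∑ k : ZMod p, (quadraticChar (ZMod p) k : ℝ) * cotRes p k =
      -2 * charMoment p := by
  have hp0 : (p : ℂ) ≠ 0 := by exact_mod_cast (Fact.out : p.Prime).ne_zero
  have hinner (j : ZMod p) : (j.val : ℂ) * ∑ k, quadCharC p k * ZMod.stdAddChar (j * k) =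
      (j.val : ℂ) * (quadCharC p j * (Complex.I * (Real.sqrt p : ℝ))) := by
    rcases eq_or_ne j 0 with rfl | hj
    · simp
    · have := gaussSum_mulShift_eq (quadCharC p) ZMod.stdAddChar (Units.mk0 j hj)
      rw [quadCharC_isQuadratic.inv, gaussSum_quadCharC hp] at this
      rw [Units.val_mk0] at this
      rw [← this]
      rfl
  have h0 : ∑ k, quadCharC p k = 0 := MulChar.sum_eq_zero_of_ne_one (quadCharC_ne_one hp)
  have h1 : ∑ k, quadCharC p k * (cotRes p k : ℂ) =
      Complex.I * (2 / p) * ∑ j : ZMod p, (j.val : ℂ) * ∑ k, quadCharC p k *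
        ZMod.stdAddChar (j * k) := by
    have (k : ZMod p) : quadCharC p k * (cotRes p k : ℂ) = Complex.I * quadCharC p k +
        ∑ j : ZMod p, Complex.I * (2 / p) * ((j.val : ℂ) * (quadCharC p k *
          ZMod.stdAddChar (j * k))) := by
      rcases eq_or_ne k 0 with rfl | hk
      · simp [quadCharC_apply]
      · rw [cotRes_eq_sum hk, mul_add, mul_add, mul_one, Finset.mul_sum, Finset.mul_sum,
          Finset.mul_sum]
        congr 1
        · ring
        · exact Finset.sum_congr rfl fun j _ => by ring
    rw [Finset.sum_congr rfl fun k _ => this k, Finset.sum_add_distrib, ← Finset.mul_sum, h0,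
      mul_zero, zero_add, Finset.sum_comm, Finset.mul_sum]
    exact Finset.sum_congr rfl fun j _ => by rw [Finset.mul_sum, Finset.mul_sum]
  rw [Finset.sum_congr rfl fun j _ => hinner j] at h1
  have h2 : ∑ k, quadCharC p k * (cotRes p k : ℂ) =
      ((∑ k : ZMod p, (quadraticChar (ZMod p) k : ℝ) * cotRes p k : ℝ) : ℂ) := by
    push_cast; rfl
  have h3 : Complex.I * (2 / p) * ∑ j : ZMod p,
      (j.val : ℂ) * (quadCharC p j * (Complex.I * (Real.sqrt p : ℝ))) =
      ((-(2 / p) * (charMoment p * Real.sqrt p) : ℝ) : ℂ) := by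
    rw [charMoment]
    push_cast
    rw [Finset.sum_mul, Finset.mul_sum, Finset.mul_sum]
    refine Finset.sum_congr rfl fun j _ => ?_
    rw [quadCharC_apply]
    linear_combination (2 / p * (j.val : ℂ) * (quadraticChar (ZMod p) j : ℤ) *
      (Real.sqrt p : ℝ)) * Complex.I_sq
  rw [h2, h3] at h1
  have h4 := Complex.ofReal_injective h1
  have hpr : (p : ℝ) ≠ 0 := by exact_mod_cast (Fact.out : p.Prime).ne_zero
  rw [h4]
  have := Real.mul_self_sqrt (Nat.cast_nonneg (α := ℝ) p)
  field_simp
  linear_combination -(charMoment p : ℝ) * this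

theorem cotSum_eq (hp : p % 4 = 3) : cotSum p = -charMoment p := by
  have h1 := two_mul_cotSum hp
  rw [sum_quadraticChar_mul_cotRes hp] at h1
  linarith

theorem charMoment_neg (hp : p % 4 = 3) : charMoment p < 0 := by
  have h1 := sum_quadraticChar_mul_cotRes hp
  have hp0 : (0 : ℝ) < p := by exact_mod_cast (Fact.out : p.Prime).pos
  have h2 := mul_pos (Real.sqrt_pos.2 hp0) (sum_quadraticChar_mul_cotRes_pos hp)
  rw [h1] at h2
  have : (charMoment p : ℝ) < 0 := by linarith
  exact_mod_cast this

end FirstMoment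

/-! ### Parity, divisibility and residue counts -/

section Arithmetic

variable {p : ℕ} [Fact p.Prime]

lemma two_mul_sum_val : 2 * ∑ j : ZMod p, (j.val : ℤ) = p * (p - 1) := by
  have hp : 1 ≤ p := (Fact.out : p.Prime).one_le
  have h1 : ∑ j : ZMod p, j.val = ∑ n ∈ Finset.range p, n := by
    rw [sum_zmod_eq_sum_range]
    exact Finset.sum_congr rfl fun n hn => ZMod.val_cast_of_lt (Finset.mem_range.1 hn)
  have h2 := Finset.sum_range_id_mul_two p
  rw [← h1] at h2
  have h3 : ((∑ j : ZMod p, j.val : ℕ) : ℤ) * 2 = p * (p - 1) := by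
    rw [← Nat.cast_one, ← Nat.cast_sub hp]; exact_mod_cast h2
  rw [Nat.cast_sum] at h3
  linarith

lemma charMoment_odd (hp : p % 4 = 3) : Odd (charMoment p) := by
  have h1 : Even (charMoment p - ∑ j : ZMod p, (j.val : ℤ)) := by
    rw [charMoment, ← Finset.sum_sub_distrib]
    refine Finset.even_sum _ fun j _ => ?_
    rcases eq_or_ne j 0 with rfl | hj
    · simp
    · rcases quadraticChar_dichotomy hj with h | h <;> rw [h]
      · simp
      · exact ⟨-j.val, by ring⟩
  have h2 : Odd (∑ j : ZMod p, (j.val : ℤ)) := by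
    obtain ⟨t, ht⟩ : ∃ t, p = 4 * t + 3 := ⟨p / 4, by omega⟩
    have h : ∑ j : ZMod p, (j.val : ℤ) = (4 * t + 3) * (2 * t + 1) := by
      have := two_mul_sum_val (p := p)
      have hc : (p : ℤ) = 4 * t + 3 := by exact_mod_cast ht
      have h4 : (p : ℤ) * (p - 1) = 2 * ((4 * t + 3) * (2 * t + 1)) := by rw [hc]; ring
      linarith
    rw [h]
    exact Odd.mul ⟨2 * t + 1, by ring⟩ ⟨t, rfl⟩
  have := h1.add_odd h2
  rwa [sub_add_cancel] at this

/-- Mod `p`, `j χ(j) = j ^ ((p + 1)/2)`; this power sum vanishes because `(p + 1)/2 < p - 1`, which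
is where `p > 3` enters. -/
lemma dvd_charMoment (hp : p % 4 = 3) (hp3 : 3 < p) : (p : ℤ) ∣ charMoment p := by
  rw [← ZMod.intCast_zmod_eq_zero_iff_dvd, charMoment, Int.cast_sum]
  rw [← FiniteField.sum_pow_lt_card_sub_one (ZMod p) (p / 2 + 1) (by rw [ZMod.card]; omega)]
  refine Finset.sum_congr rfl fun j _ => ?_
  rw [Int.cast_mul, quadraticChar_eq_pow_of_char_ne_two' (ringChar_zmod_ne_two hp), ZMod.card,
    pow_succ]
  simp

lemma neg_charMoment_lt (hp3 : 3 < p) : -charMoment p < p ^ 2 := by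
  have h1 : -charMoment p ≤ ∑ j : ZMod p, (j.val : ℤ) := by
    rw [charMoment, ← Finset.sum_neg_distrib]
    refine Finset.sum_le_sum fun j _ => ?_
    have hv : (0 : ℤ) ≤ j.val := Int.natCast_nonneg _
    rcases quadraticChar_isQuadratic (ZMod p) j with h | h | h <;> rw [h] <;> linarith
  have h2 := two_mul_sum_val (p := p)
  have : (3 : ℤ) < p := by exact_mod_cast hp3
  nlinarith

/-- The character sum over the odd integers in `[0, p)`. -/
noncomputable def oddCharSum (p : ℕ) [Fact p.Prime] : ℤ :=
  ∑ j : ZMod p, quadraticChar (ZMod p) j * if Odd j.val then 1 else 0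

/-- As `p` is odd, doubling wraps past `p` exactly when the reduced result is odd. -/
lemma val_two_mul (hp : p % 4 = 3) (j : ZMod p) :
    ((2 * j).val : ℤ) = 2 * j.val - p * if Odd (2 * j).val then 1 else 0 := by
  have hj := ZMod.val_lt j
  rw [two_mul]
  rcases lt_or_ge (j.val + j.val) p with h | h
  · rw [ZMod.val_add_of_lt h, if_neg (by rw [Nat.not_odd_iff_even]; exact ⟨_, rfl⟩)]
    push_cast
    ring
  · have h1 := ZMod.val_add_val_of_le h
    rw [if_pos (by rw [Nat.odd_iff]; omega)]
    have : (j.val : ℤ) + j.val = (j + j).val + p := by exact_mod_cast h1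
    linarith

/-- Weight the doubling formula by `χ(k)` and substitute `2k`: with `χ(2) = -1` and `S` the odd sum
it reads `-M = 2M + pS`. -/
lemma mul_oddCharSum (hp : p % 8 = 3) : p * oddCharSum p = -3 * charMoment p := by
  have hp4 : p % 4 = 3 := by omega
  have h1 := sum_quadraticChar_mul_comp_two_mul hp4 (fun k : ZMod p => (k.val : ℝ))
  have h2 := sum_quadraticChar_mul_comp_two_mul hp4
    (fun k : ZMod p => if Odd k.val then (1 : ℝ) else 0)
  rw [quadraticChar_two_eq_neg_one hp] at h1 h2
  have e (k : ZMod p) : ((2 * k).val : ℝ) =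
      2 * k.val - p * if Odd (2 * k).val then (1 : ℝ) else 0 := by
    exact_mod_cast val_two_mul hp4 k
  have h3 : ∑ k : ZMod p, (quadraticChar (ZMod p) k : ℝ) * ((2 * k).val : ℝ) =
      2 * ∑ k : ZMod p, (quadraticChar (ZMod p) k : ℝ) * (k.val : ℝ) -
      p * ∑ k : ZMod p, (quadraticChar (ZMod p) k : ℝ) *
        if Odd (2 * k).val then (1 : ℝ) else 0 := by
    rw [Finset.mul_sum, Finset.mul_sum, ← Finset.sum_sub_distrib]
    refine Finset.sum_congr rfl fun k _ => ?_
    rw [e]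
    ring
  have h4 : (charMoment p : ℝ) = ∑ k : ZMod p, (quadraticChar (ZMod p) k : ℝ) * (k.val : ℝ) := by
    rw [charMoment]; push_cast; rfl
  have h5 : (oddCharSum p : ℝ) = ∑ k : ZMod p, (quadraticChar (ZMod p) k : ℝ) *
      if Odd k.val then (1 : ℝ) else 0 := by
    rw [oddCharSum]; push_cast; rfl
  rw [h3, h2, ← h4, ← h5] at h1
  push_cast at h1
  have : (p : ℝ) * oddCharSum p = -3 * charMoment p := by linarith
  exact_mod_cast this

lemma oddResidues_sub_evenResidues (hp : p % 4 = 3) :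
    (oddResidues p : ℤ) - evenResidues p = oddCharSum p := by
  classical
  set s : ZMod p → ℤ := fun j => if j = 0 then 0 else if Odd j.val then 1 else -1 with hs
  have hsodd : Function.Odd (fun j => (s j : ℝ)) := by
    intro j
    rcases eq_or_ne j 0 with rfl | hj
    · simp [hs]
    · have hlt := ZMod.val_lt j
      have hneg : Odd (-j).val ↔ ¬ Odd j.val := by
        rw [ZMod.neg_val, if_neg hj, Nat.odd_iff, Nat.odd_iff]; omega
      simp only [hs, neg_eq_zero, hj, if_false, hneg]
      split_ifs <;> simp
  have hs0 : ∑ j, s j = 0 := by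
    have := sum_eq_zero_of_odd hsodd
    exact_mod_cast this
  have h1 : (oddResidues p : ℤ) - evenResidues p =
      ∑ j : ZMod p, if IsSquare j then s j else 0 := by
    have hp0 : p = p - 1 + 1 := by have := (Fact.out : p.Prime).pos; omega
    rw [sum_zmod_eq_sum_range, Finset.sum_congr (congrArg Finset.range hp0) fun _ _ => rfl,
      Finset.sum_range_succ', ← sum_Icc_one_eq_sum_range
        (fun n => if IsSquare (n : ZMod p) then s (n : ZMod p) else 0)]
    rw [oddResidues, evenResidues, Finset.card_filter, Finset.card_filter, Nat.cast_sum,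
      Nat.cast_sum, ← Finset.sum_sub_distrib]
    simp only [hs, Nat.cast_zero, if_true, ite_self, add_zero]
    refine Finset.sum_congr rfl fun n hn => ?_
    have hn' := Finset.mem_Icc.1 hn
    have hv : (n : ZMod p).val = n := ZMod.val_cast_of_lt (by omega)
    have hne : (n : ZMod p) ≠ 0 := fun h => by
      rw [h, ZMod.val_zero] at hv; omega
    rw [if_neg hne, hv]
    by_cases hsq : IsSquare (n : ZMod p) <;> by_cases ho : Odd n <;>
      simp [hsq, ho, ← Nat.not_odd_iff_even]
  -- Away from 0, twice the indicator of squares is `χ + 1`, and `s` is `2·[odd] - 1`; the sums of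
  -- `χ` and `s` both vanish.
  have h2 : ∑ j : ZMod p, 2 * (if IsSquare j then s j else 0) =
      ∑ j : ZMod p, ((2 * (quadraticChar (ZMod p) j * if Odd j.val then 1 else 0)) -
        quadraticChar (ZMod p) j + s j) := by
    refine Finset.sum_congr rfl fun j _ => ?_
    rcases eq_or_ne j 0 with rfl | hj
    · simp [hs]
    · simp only [hs, hj, if_false]
      by_cases hsq : IsSquare j
      · rw [(quadraticChar_one_iff_isSquare hj).2 hsq, if_pos hsq]; split_ifs <;> norm_num
      · rw [quadraticChar_neg_one_iff_not_isSquare.2 hsq, if_neg hsq]; split_ifs <;> norm_num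
  rw [← Finset.mul_sum, ← h1, Finset.sum_add_distrib, Finset.sum_sub_distrib, ← Finset.mul_sum,
    hs0, quadraticChar_sum_zero (ringChar_zmod_ne_two hp)] at h2
  rw [oddCharSum]
  linarith

lemma cotSum_three : cotSum 3 = 1 := by
  rw [cotSum]
  have h : Real.pi * ((1 : ℕ) : ℝ) ^ 2 / ((3 : ℕ) : ℝ) = Real.pi / 3 := by norm_num
  have h3 : Real.sqrt 3 ≠ 0 := by positivity
  rw [show (3 - 1) / 2 = 1 by norm_num, Finset.Icc_self, Finset.sum_singleton, h,
    Real.cot_eq_cos_div_sin, Real.cos_pi_div_three, Real.sin_pi_div_three, Nat.cast_ofNat]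
  field_simp

end Arithmetic

theorem mainTheorem4 :
    cotSum 3 = 1 ∧
    (∀ p : ℕ, p.Prime → p % 4 = 3 → 3 < p →
      ∃ c : ℕ, cotSum p = (c : ℝ) ∧ Odd c ∧ 0 < c ∧ p ∣ c ∧ ¬ p ^ 2 ∣ c) ∧
    (∀ p : ℕ, p.Prime → p % 8 = 3 → ∃ t : ℤ, tanSum p = ((3 * t : ℤ) : ℝ)) ∧
    (∀ p : ℕ, p.Prime → p % 8 = 3 → 3 < p →
      ∃ m : ℕ, 0 < m ∧ (oddResidues p : ℤ) - (evenResidues p : ℤ) = 3 * (m : ℤ)) := by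
  refine ⟨cotSum_three, fun p hpp hp hp3 => ?_, fun p hpp hp => ?_, fun p hpp hp hp3 => ?_⟩
  · have : Fact p.Prime := ⟨hpp⟩
    have hneg := charMoment_neg hp
    obtain ⟨c, hc⟩ := Int.eq_ofNat_of_zero_le (neg_nonneg.2 hneg.le)
    have hcpos : 0 < c := by omega
    refine ⟨c, ?_, ?_, hcpos, ?_, fun hd => ?_⟩
    · rw [cotSum_eq hp]; exact_mod_cast hc
    · have h := (charMoment_odd hp).neg
      rw [hc] at h
      exact_mod_cast h
    · have h := (dvd_neg (α := ℤ)).2 (dvd_charMoment hp hp3)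
      rw [hc] at h
      exact_mod_cast h
    · have h := neg_charMoment_lt hp3
      rw [hc] at h
      exact absurd (Nat.le_of_dvd hcpos hd) (not_le.2 (by exact_mod_cast h))
  · have : Fact p.Prime := ⟨hpp⟩
    have hp4 : p % 4 = 3 := by omega
    refine ⟨-charMoment p, ?_⟩
    rw [tanSum_eq hp4, cotSum_eq hp4, quadraticChar_two_eq_neg_one hp]
    push_cast
    ring
  · have : Fact p.Prime := ⟨hpp⟩
    have hp4 : p % 4 = 3 := by omega
    have hp0 : (0 : ℤ) < p := by exact_mod_cast hpp.pos
    have hneg := charMoment_neg hp4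
    obtain ⟨k, hk⟩ := dvd_charMoment hp4 hp3
    have hkneg : k < 0 := by
      rw [hk] at hneg
      exact neg_of_mul_neg_right hneg hp0.le
    -- The witness is `m = -M/p`, that is `C(p)/p`.
    obtain ⟨m, hm⟩ := Int.eq_ofNat_of_zero_le (neg_nonneg.2 hkneg.le)
    refine ⟨m, by omega, ?_⟩
    have h := mul_oddCharSum hp
    rw [hk] at h
    rw [oddResidues_sub_evenResidues hp4]
    refine mul_left_cancel₀ hp0.ne' ?_
    rw [h]
    linear_combination 3 * (p : ℤ) * hm
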